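/- Let $A\in\mathbb{R}^{n\times n}$, $C\in\mathbb{R}^{m\times n}$, let $\Sigma_w\succeq 0$ and $\Sigma_v\succ 0$ be the covariances of the process and measurement noises of $x(k+1)=Ax(k)+w(k)$, $y(k)=Cx(k)+v(k)$, and assume that $(A,C)$ is detectable and $(A,\sqrt{\Sigma_w})$ is stabilizable. Let $\overline P\succeq 0$ be the steady-state (a posteriori) error covariance of the Kalman filter, i.e. $\overline P=M-MC^\top(CMC^\top+\Sigma_v)^{-1}CM$ with $M=A\overline PA^\top+\Sigma_w$. For $\tau\in\mathbb{N}=\{0,1,2,\dots\}$ put $$P(\tau)=A^{\tau}\overline P(A^\top)^{\tau}+\sum_{t=0}^{\tau-1}A^t\Sigma_w(A^\top)^t .$$ Let $\lambda\ge 0$ (cost per transmission) and $r_s\in[0,1]$ (probability that a transmission succeeds). Consider the Markov decision process with states $\tau\in\mathbb{N}$, actions $a\in\{0,1\}$, one-stage cost $c(\tau,a)=\mathrm{Tr}(P(\tau))+\lambda a$, and transitions $\Pr(0\mid\tau,1)=r_s$, $\Pr(\tau+1\mid\tau,1)=1-r_s$, $\Pr(\tau+1\mid\tau,0)=1$, started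 at $\tau(0)=0$. An admissible policy $f=(f_k)_{k\ge0}$ chooses $a(k)=f_k(\tau(0),\dots,\tau(k),a(0),\dots,a(k-1))\in\{0,1\}$; it is Markovian if $a(k)=f_k(\tau(k))$, and stationary if moreover $f_k$ does not depend on $k$. For an admissible policy $f$ let $$J_e(f)=\limsup_{T\to\infty}\frac1{T+1}\mathbb{E}^f\Big[\sum_{k=0}^{T}\mathrm{Tr}(P(\tau(k)))\Big],\quad J_r(f)=\limsup_{T\to\infty}\frac1{T+1}\mathbb{E}^f\Big[\sum_{k=0}^{T}a(k)\Big],$$ $$J(f)=\limsup_{T\to\infty}\frac1{T+1}\mathbb{E}^f\Big[\sum_{k=0}^{T}c(\tau(k),a(k))\Big],$$ with values in $[0,\infty]$. Lemma. Let $\rho(A)$ be the spectral radius of $A$. If $\rho^2(A)(1-r_s)<1$, then there are a real number $\mathcal J^\star\ge0$, a function $V:\mathbb{N}\to\mathbb{R}$ that is bounded below, and a stationary policy $f^\star:\mathbb{N}\to\{0,1\}$ such that (i) $\mathcal J^\star$ is the optimal average cost: $\mathcal J^\star=\inf_f\,[J_e(f)+\lambda J_r(f)]$ over all admissible policies (the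 costly communication problem), and $\mathcal J^\star=\inf_f J(f)$ over all Markovian policies; (ii) the average-cost Bellman optimality equation holds, and $a=f^\star(\tau)$ attains its minimum: for every $\tau\in\mathbb{N}$, $$V(\tau)=\min_{a\in\{0,1\}}\Big[c(\tau,a)+\sum_{\tau_+}V(\tau_+)\Pr(\tau_+\mid\tau,a)-\mathcal J^\star\Big]=c(\tau,f^\star(\tau))+\sum_{\tau_+}V(\tau_+)\Pr(\tau_+\mid\tau,f^\star(\tau))-\mathcal J^\star;$$ (iii) $f^\star$ is average-cost optimal: $J_e(f^\star)+\lambda J_r(f^\star)=J(f^\star)=\mathcal J^\star$, and $J(f)\ge\mathcal J^\star$ for every admissible policy $f$. -/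

import Mathlib

open scoped ENNReal Matrix

noncomputable section

namespace SensorScheduling

/-! ### The linear system and the steady-state Kalman filter -/

/-- The spectral radius of a real square matrix: the largest modulus of its complex eigenvalues
(a finite number, the spectrum being finite; it is `0` for the empty matrix). -/
def specRad {n : ℕ} (A : Matrix (Fin n) (Fin n) ℝ) : ℝ :=
  (spectralRadius ℂ (A.map (algebraMap ℝ ℂ))).toReal

/-- The pair `(A, C)` is detectable: some output injection makes `A - L C` Schur stable. -/
def Detectable {n m : ℕ} (A : Matrix (Fin n) (Fin n) ℝ) (C : Matrix (Fin m) (Fin n) ℝ) : Prop :=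
  ∃ L : Matrix (Fin n) (Fin m) ℝ, specRad (A - L * C) < 1

/-- The pair `(A, B)` is stabilizable: some feedback makes `A - B K` Schur stable. -/
def Stabilizable {n p : ℕ} (A : Matrix (Fin n) (Fin n) ℝ) (B : Matrix (Fin n) (Fin p) ℝ) : Prop :=
  ∃ K : Matrix (Fin p) (Fin n) ℝ, specRad (A - B * K) < 1

/-- `(A, √W)` is stabilizable, where `√W` is the positive semidefinite square root of `W`. -/
def StabilizableSqrt {n : ℕ} (A W : Matrix (Fin n) (Fin n) ℝ) : Prop :=
  ∃ S : Matrix (Fin n) (Fin n) ℝ, S.PosSemidef ∧ S * S = W ∧ Stabilizable A S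

/-- The time update `A P Aᵀ + W` of an error covariance. -/
def kalmanPredict {n : ℕ} (A W P : Matrix (Fin n) (Fin n) ℝ) : Matrix (Fin n) (Fin n) ℝ :=
  A * P * Aᵀ + W

/-- The measurement update `M - M Cᵀ (C M Cᵀ + R)⁻¹ C M` of an error covariance. -/
def kalmanCorrect {n m : ℕ} (C : Matrix (Fin m) (Fin n) ℝ) (R : Matrix (Fin m) (Fin m) ℝ)
    (M : Matrix (Fin n) (Fin n) ℝ) : Matrix (Fin n) (Fin n) ℝ :=
  M - M * Cᵀ * (C * M * Cᵀ + R)⁻¹ * C * M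

/-- `Pbar` is the steady-state (a posteriori) estimation error covariance of the Kalman filter for
`x(k+1) = A x(k) + w(k)`, `y(k) = C x(k) + v(k)` with noise covariances `W` and `R`: it is
positive semidefinite and invariant under one step of the covariance recursion. -/
structure IsSteadyStateCov {n m : ℕ} (A : Matrix (Fin n) (Fin n) ℝ) (C : Matrix (Fin m) (Fin n) ℝ)
    (W : Matrix (Fin n) (Fin n) ℝ) (R : Matrix (Fin m) (Fin m) ℝ)
    (Pbar : Matrix (Fin n) (Fin n) ℝ) : Prop where
  posSemidef : Pbar.PosSemidef
  fixed : kalmanCorrect C R (kalmanPredict A W Pbar) = Pbar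

/-- The error covariance `P(τ)` of the remote estimator when the last successful transmission
occurred `τ` steps ago (the sum is empty and `P(0) = Pbar` for `τ = 0`). -/
def errCov {n : ℕ} (A W Pbar : Matrix (Fin n) (Fin n) ℝ) (τ : ℕ) : Matrix (Fin n) (Fin n) ℝ :=
  A ^ τ * Pbar * Aᵀ ^ τ + ∑ t ∈ Finset.range τ, A ^ t * W * Aᵀ ^ t

/-! ### The Markov decision process: states `ℕ`, actions `{0, 1}` -/

/-- The estimation part `Tr P(τ)` of the one-stage cost. -/
def estCost {n : ℕ} (A W Pbar : Matrix (Fin n) (Fin n) ℝ) (τ : ℕ) (_a : Fin 2) : ℝ :=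
  (errCov A W Pbar τ).trace

/-- The communication part of the one-stage cost: `1` for a transmission and `0` otherwise. -/
def commCost (_τ : ℕ) (a : Fin 2) : ℝ := ((a : ℕ) : ℝ)

/-- The one-stage cost `c(τ, a) = Tr P(τ) + lam * a`. -/
def stageCost {n : ℕ} (A W Pbar : Matrix (Fin n) (Fin n) ℝ) (lam : ℝ) (τ : ℕ) (a : Fin 2) : ℝ :=
  estCost A W Pbar τ a + lam * commCost τ a

/-- The transition probability `Pr(τ' | τ, a)`. -/
def transProb (r : ℝ) (τ : ℕ) (a : Fin 2) (τ' : ℕ) : ℝ :=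
  if τ' = 0 ∧ a = 1 then r
  else if τ' = τ + 1 ∧ a = 1 then 1 - r
  else if τ' = τ + 1 ∧ a = 0 then 1
  else 0

theorem transProb_hasSum (r : unitInterval) (τ : ℕ) (a : Fin 2) :
    HasSum (fun τ' => ENNReal.ofReal (transProb r τ a τ')) 1 := by
  have h : ∑ τ' ∈ ({0, τ + 1} : Finset ℕ), ENNReal.ofReal (transProb r τ a τ') = 1 := by
    rw [Finset.sum_pair (by omega)]
    fin_cases a
    · simp [transProb]
    · simp only [transProb]
      simp only [Fin.mk_one, and_self, if_true, Nat.add_eq_zero_iff, one_ne_zero, and_false,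
        false_and, if_false]
      rw [← ENNReal.ofReal_add r.2.1 (by linarith [r.2.2])]
      simp
  rw [← h]
  refine hasSum_sum_of_ne_finset_zero fun b hb => ?_
  simp only [Finset.mem_insert, Finset.mem_singleton, not_or] at hb
  simp [transProb, hb.1, hb.2]

/-- The law of the next state, when action `a` is taken in state `τ`. -/
def transLaw (r : unitInterval) (τ : ℕ) (a : Fin 2) : PMF ℕ :=
  ⟨fun τ' => ENNReal.ofReal (transProb r τ a τ'), transProb_hasSum r τ a⟩

/-- The information `(τ_{0:k}, a_{0:k-1})` available at time `k`. -/
abbrev History (k : ℕ) : Type := (Fin (k + 1) → ℕ) × (Fin k → Fin 2)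

/-- An admissible policy `f = (f_k)`: `a(k) = f_k(τ_{0:k}, a_{0:k-1})`. -/
abbrev Policy : Type := (k : ℕ) → History k → Fin 2

/-- The Markovian policy `a(k) = g_k(τ(k))`. -/
def markovPolicy (g : ℕ → ℕ → Fin 2) : Policy := fun k h => g k (h.1 (Fin.last k))

/-- The stationary policy `a(k) = g(τ(k))`. -/
def stationaryPolicy (g : ℕ → Fin 2) : Policy := markovPolicy fun _ => g

/-- The law of the history `(τ_{0:k}, a_{0:k-1})` under the policy `f`, started at `τ(0) = 0`. -/
def historyLaw (r : unitInterval) (f : Policy) : (k : ℕ) → PMF (History k)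
  | 0 => PMF.pure (fun _ => 0, Fin.elim0)
  | k + 1 => (historyLaw r f k).bind fun h =>
      (transLaw r (h.1 (Fin.last k)) (f k h)).map fun τ' =>
        (Fin.snoc (α := fun _ => ℕ) h.1 τ', Fin.snoc (α := fun _ => Fin 2) h.2 (f k h))

/-- The expectation `𝔼^f[c(τ(k), a(k)) | τ(0) = 0]` of a nonnegative one-stage cost `c`. -/
def expectedStage (r : unitInterval) (f : Policy) (c : ℕ → Fin 2 → ℝ) (k : ℕ) : ℝ≥0∞ :=
  ∑' h : History k, historyLaw r f k h * ENNReal.ofReal (c (h.1 (Fin.last k)) (f k h))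

/-- The long-run expected average of a nonnegative one-stage cost `c` under the policy `f`:
`limsup_T 1/(T+1) 𝔼^f[∑_{k=0}^T c(τ(k), a(k)) | τ(0) = 0]`, with value `∞` allowed. -/
def avgCost (r : unitInterval) (f : Policy) (c : ℕ → Fin 2 → ℝ) : ℝ≥0∞ :=
  Filter.limsup (fun T : ℕ =>
    (∑ k ∈ Finset.range (T + 1), expectedStage r f c k) / ((T : ℝ≥0∞) + 1)) Filter.atTop

/-- The objective `J_e(f) + lam * J_r(f)` of the costly communication problem (`0 ≤ lam`). -/
def costlyObjective {n : ℕ} (A W Pbar : Matrix (Fin n) (Fin n) ℝ) (lam : ℝ) (r : unitInterval)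
    (f : Policy) : ℝ≥0∞ :=
  avgCost r f (estCost A W Pbar) + ENNReal.ofReal lam * avgCost r f commCost

/-- The right-hand side `c(τ, a) + ∑_{τ'} V(τ') Pr(τ' | τ, a) - J` of the Bellman equation before
minimization over `a` (the sum has at most two nonzero terms). -/
def bellmanTerm {n : ℕ} (A W Pbar : Matrix (Fin n) (Fin n) ℝ) (lam r : ℝ) (V : ℕ → ℝ) (J : ℝ)
    (τ : ℕ) (a : Fin 2) : ℝ :=
  stageCost A W Pbar lam τ a + ∑' τ' : ℕ, V τ' * transProb r τ a τ' - J

end SensorScheduling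

end

/-! The state cost `p τ = Tr P(τ)` is nondecreasing, because a Kalman measurement never increases
the error covariance. Natural candidates are therefore the policies that transmit exactly when `τ ≥
θ`. With `S θ = ∑ (1-r)^j p(θ+j)`, a renewal cycle between successes has mean length `θ + 1/r` and
mean cost `∑_{s<θ} p s + S θ + lam/r`; let `D θ` be the quotient. `D (θ+1)` is a weighted mean of `D
θ` and `r S(θ+1)` (`thresholdCost_succ`), and `S` is nondecreasing, so the first `θ` with `D θ ≤ r
S(θ+1)` is optimal. If there is none, `p` is bounded and never transmitting is optimal, with value
`sup p`. In both cases the relative value function is explicit.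

Optimality is a verification argument. Poisson equations with solutions bounded below give upper
bounds (`avgCost_le`), separately for the estimation and the communication cost. For the lower bound
under an arbitrary policy the relative value function may be unbounded, so it is replaced by bounded
`ε`-subsolutions, obtained by truncation (`le_avgCost`).

The assumption on the spectral radius enters through Gelfand's formula: it makes `S` finite for `r >
0`, and `p` bounded for `r = 0`. -/

noncomputable section

namespace SensorScheduling

open Filter

/-! ### Expectations along the controlled chain -/

/-- The expected value of `V` after action `a` in state `τ`. -/
def nextValue (r : ℝ) (V : ℕ → ℝ) (τ : ℕ) (a : Fin 2) : ℝ :=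
  if a = 1 then r * V 0 + (1 - r) * V (τ + 1) else V (τ + 1)

theorem tsum_mul_transProb (r : ℝ) (V : ℕ → ℝ) (τ : ℕ) (a : Fin 2) :
    ∑' τ', V τ' * transProb r τ a τ' = nextValue r V τ a := by
  rw [tsum_eq_sum (s := {0, τ + 1}), Finset.sum_pair (by omega)]
  · fin_cases a <;> simp [transProb, nextValue, mul_comm]
  · intro b hb
    simp only [Finset.mem_insert, Finset.mem_singleton, not_or] at hb
    simp [transProb, hb.1, hb.2]

/-- `nextValue` commutes with affine combinations. -/
theorem nextValue_add_const (r : ℝ) (V : ℕ → ℝ) (b : ℝ) (τ : ℕ) (a : Fin 2) :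
    nextValue r (fun t => V t + b) τ a = nextValue r V τ a + b := by
  unfold nextValue; split_ifs <;> ring

theorem nextValue_add_mul (r : ℝ) (V W : ℕ → ℝ) (b : ℝ) (τ : ℕ) (a : Fin 2) :
    nextValue r (fun t => V t + b * W t) τ a = nextValue r V τ a + b * nextValue r W τ a := by
  unfold nextValue; split_ifs <;> ring

theorem nextValue_nonneg (r : unitInterval) {V : ℕ → ℝ} (hV : ∀ τ, 0 ≤ V τ) (τ : ℕ) (a : Fin 2) :
    0 ≤ nextValue r V τ a := by
  have h1 : (0 : ℝ) ≤ 1 - r := sub_nonneg.2 r.2.2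
  unfold nextValue
  split_ifs
  · exact add_nonneg (mul_nonneg r.2.1 (hV _)) (mul_nonneg h1 (hV _))
  · exact hV _

theorem tsum_transLaw_mul_ofReal (r : unitInterval) {V : ℕ → ℝ} (hV : ∀ τ, 0 ≤ V τ) (τ : ℕ)
    (a : Fin 2) :
    ∑' τ', transLaw r τ a τ' * ENNReal.ofReal (V τ') = ENNReal.ofReal (nextValue r V τ a) := by
  have h0 : ∀ τ', 0 ≤ transProb r τ a τ' := fun τ' => by
    unfold transProb
    split_ifs
    exacts [r.2.1, sub_nonneg.2 r.2.2, zero_le_one, le_rfl]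
  have hs : ∀ b ∉ ({0, τ + 1} : Finset ℕ), V b * transProb r τ a b = 0 := fun b hb => by
    simp only [Finset.mem_insert, Finset.mem_singleton, not_or] at hb
    simp [transProb, hb.1, hb.2]
  rw [← tsum_mul_transProb, ENNReal.ofReal_tsum_of_nonneg
    (fun t => mul_nonneg (hV t) (h0 t)) (summable_of_ne_finset_zero hs)]
  refine tsum_congr fun t => ?_
  rw [ENNReal.ofReal_mul (hV t), mul_comm]
  rfl

theorem tsum_bind_mul {α β : Type*} (p : PMF α) (g : α → PMF β) (F : β → ℝ≥0∞) :
    ∑' b, p.bind g b * F b = ∑' a, p a * ∑' b, g a b * F b := by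
  simp_rw [PMF.bind_apply, ← ENNReal.tsum_mul_right, ← ENNReal.tsum_mul_left]
  rw [ENNReal.tsum_comm]
  simp_rw [mul_assoc]

theorem tsum_map_mul {α β : Type*} (p : PMF α) (g : α → β) (F : β → ℝ≥0∞) :
    ∑' b, p.map g b * F b = ∑' a, p a * F (g a) := by
  classical
  rw [PMF.map, tsum_bind_mul]
  refine tsum_congr fun a => ?_
  rw [tsum_eq_single (g a)]
  · simp
  · intro b hb
    simp [PMF.pure_apply, hb]

/-- The expectation of `v (τ(k))` under the policy `f`. -/
def expectedState (r : unitInterval) (f : Policy) (v : ℕ → ℝ≥0∞) (k : ℕ) : ℝ≥0∞ :=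
  ∑' h : History k, historyLaw r f k h * v (h.1 (Fin.last k))

theorem expectedState_zero (r : unitInterval) (f : Policy) (v : ℕ → ℝ≥0∞) :
    expectedState r f v 0 = v 0 := by
  classical
  unfold expectedState
  rw [tsum_eq_single ((fun _ => 0, Fin.elim0) : History 0)]
  · simp [historyLaw]
  · intro b hb
    simp [historyLaw, PMF.pure_apply, hb]

theorem expectedState_succ (r : unitInterval) (f : Policy) {V : ℕ → ℝ} (hV : ∀ τ, 0 ≤ V τ)
    (k : ℕ) :
    expectedState r f (fun τ => ENNReal.ofReal (V τ)) (k + 1) =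
      expectedStage r f (nextValue r V) k := by
  unfold expectedState expectedStage
  rw [historyLaw, tsum_bind_mul]
  refine tsum_congr fun h => ?_
  rw [tsum_map_mul, ← tsum_transLaw_mul_ofReal r hV]
  simp

theorem expectedState_le (r : unitInterval) (f : Policy) {v : ℕ → ℝ≥0∞} {K : ℝ≥0∞}
    (hv : ∀ τ, v τ ≤ K) (k : ℕ) : expectedState r f v k ≤ K := by
  calc expectedState r f v k ≤ ∑' h : History k, historyLaw r f k h * K :=
        ENNReal.tsum_le_tsum fun h => by gcongr; exact hv _
    _ = K := by rw [ENNReal.tsum_mul_right, PMF.tsum_coe, one_mul]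

theorem expectedStage_add (r : unitInterval) (f : Policy) {c d : ℕ → Fin 2 → ℝ}
    (hc : ∀ τ a, 0 ≤ c τ a) (hd : ∀ τ a, 0 ≤ d τ a) (k : ℕ) :
    expectedStage r f (fun τ a => c τ a + d τ a) k =
      expectedStage r f c k + expectedStage r f d k := by
  unfold expectedStage
  rw [← ENNReal.tsum_add]
  refine tsum_congr fun h => ?_
  rw [ENNReal.ofReal_add (hc _ _) (hd _ _), mul_add]

theorem expectedStage_const_mul (r : unitInterval) (f : Policy) {b : ℝ} (hb : 0 ≤ b)
    (c : ℕ → Fin 2 → ℝ) (k : ℕ) :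
    expectedStage r f (fun τ a => b * c τ a) k = ENNReal.ofReal b * expectedStage r f c k := by
  unfold expectedStage
  rw [← ENNReal.tsum_mul_left]
  refine tsum_congr fun h => ?_
  rw [ENNReal.ofReal_mul hb, mul_left_comm]

theorem expectedStage_state (r : unitInterval) (f : Policy) (V : ℕ → ℝ) (k : ℕ) :
    expectedStage r f (fun τ _ => V τ) k =
      expectedState r f (fun τ => ENNReal.ofReal (V τ)) k := rfl

theorem expectedStage_const (r : unitInterval) (f : Policy) (b : ℝ) (k : ℕ) :
    expectedStage r f (fun _ _ => b) k = ENNReal.ofReal b := by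
  unfold expectedStage
  rw [ENNReal.tsum_mul_right, PMF.tsum_coe, one_mul]

theorem expectedStage_mono (r : unitInterval) (f : Policy) {c d : ℕ → Fin 2 → ℝ} {k : ℕ}
    (h : ∀ x : History k, c (x.1 (Fin.last k)) (f k x) ≤ d (x.1 (Fin.last k)) (f k x)) :
    expectedStage r f c k ≤ expectedStage r f d k :=
  ENNReal.tsum_le_tsum fun x => by gcongr; exact h x

/-! ### Bounds on average costs -/

theorem tendsto_const_div_natCast_add_one {K : ℝ≥0∞} (hK : K ≠ ∞) :
    Tendsto (fun T : ℕ => K / ((T : ℝ≥0∞) + 1)) atTop (nhds 0) := by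
  have h : Tendsto (fun T : ℕ => K / ((T + 1 : ℕ) : ℝ≥0∞)) atTop (nhds 0) :=
    (ENNReal.Tendsto.const_div ENNReal.tendsto_nat_nhds_top (Or.inr hK)).comp
      (tendsto_add_atTop_nat 1) |>.trans (by simp)
  simpa using h

theorem mul_natCast_add_one_div (J : ℝ≥0∞) (T : ℕ) :
    ((T : ℝ≥0∞) + 1) * J / ((T : ℝ≥0∞) + 1) = J := by
  rw [mul_comm]
  exact ENNReal.mul_div_cancel_right (by simp) (by finiteness)

/-- A cost satisfying a Poisson inequality with a function bounded below has a bounded average. -/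
theorem avgCost_le (r : unitInterval) (f : Policy) {c : ℕ → Fin 2 → ℝ} (hc : ∀ τ a, 0 ≤ c τ a)
    {J : ℝ} (hJ : 0 ≤ J) {V : ℕ → ℝ} (hV : BddBelow (Set.range V))
    (h : ∀ (k : ℕ) (x : History k),
      c (x.1 (Fin.last k)) (f k x) - J + nextValue r V (x.1 (Fin.last k)) (f k x) ≤
        V (x.1 (Fin.last k))) :
    avgCost r f c ≤ ENNReal.ofReal J := by
  obtain ⟨B, hB⟩ := hV
  -- Shifting by the lower bound changes nothing in the Poisson inequality and makes all
  -- expectations meaningful in `ℝ≥0∞`.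
  set U : ℕ → ℝ := fun t => V t + -B
  have hU : ∀ t, 0 ≤ U t := fun t => by
    have := hB (Set.mem_range_self t); simp only [U]; linarith
  set u : ℕ → ℝ≥0∞ := fun t => ENNReal.ofReal (U t)
  have step : ∀ k, expectedStage r f c k + expectedState r f u (k + 1) ≤
      expectedState r f u k + ENNReal.ofReal J := fun k => by
    rw [expectedState_succ r f hU, ← expectedStage_state, ← expectedStage_const r f J k,
      ← expectedStage_add r f hc (nextValue_nonneg r hU),
      ← expectedStage_add r f (fun τ _ => hU τ) (fun _ _ => hJ)]
    refine expectedStage_mono r f fun x => ?_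
    have := h k x
    simp only [U, nextValue_add_const]
    linarith
  have sum : ∀ T : ℕ, ∑ k ∈ Finset.range T, expectedStage r f c k + expectedState r f u T ≤
      u 0 + T * ENNReal.ofReal J := fun T => by
    induction T with
    | zero => simp [expectedState_zero]
    | succ T ih =>
      rw [Finset.sum_range_succ, add_assoc]
      calc _ ≤ ∑ k ∈ Finset.range T, expectedStage r f c k +
            (expectedState r f u T + ENNReal.ofReal J) := add_le_add le_rfl (step T)
        _ ≤ u 0 + T * ENNReal.ofReal J + ENNReal.ofReal J := by rw [← add_assoc]; gcongr
        _ = _ := by push_cast; ring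
  have lim : Tendsto (fun T : ℕ => u 0 / ((T : ℝ≥0∞) + 1) + ENNReal.ofReal J) atTop
      (nhds (ENNReal.ofReal J)) := by
    simpa using (tendsto_const_div_natCast_add_one (K := u 0) ENNReal.ofReal_ne_top).add
      (tendsto_const_nhds (x := ENNReal.ofReal J))
  unfold avgCost
  rw [← lim.limsup_eq]
  refine limsup_le_limsup (Eventually.of_forall fun T => ?_)
  beta_reduce
  rw [← mul_natCast_add_one_div (ENNReal.ofReal J) T, ← ENNReal.add_div]
  -- The terminal expectation is nonnegative and is dropped; no upper bound on `V` is needed.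
  refine ENNReal.div_le_div_right ?_ _
  refine le_trans le_self_add ((sum (T + 1)).trans ?_)
  push_cast
  exact le_rfl

/-- A bounded approximate subsolution of the Bellman equation bounds all average costs from
below. -/
theorem le_avgCost_add (r : unitInterval) (f : Policy) {c : ℕ → Fin 2 → ℝ}
    (hc : ∀ τ a, 0 ≤ c τ a) {J ε : ℝ} (hJ : 0 ≤ J) (hε : 0 ≤ ε) {U : ℕ → ℝ}
    (hU : BddBelow (Set.range U)) (hU' : BddAbove (Set.range U))
    (h : ∀ τ a, U τ ≤ c τ a - J + ε + nextValue r U τ a) :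
    ENNReal.ofReal J ≤ avgCost r f c + ENNReal.ofReal ε := by
  obtain ⟨B, hB⟩ := hU
  obtain ⟨K, hK⟩ := hU'
  set V : ℕ → ℝ := fun t => U t + -B
  have hV : ∀ t, 0 ≤ V t := fun t => by
    have := hB (Set.mem_range_self t); simp only [V]; linarith
  set u : ℕ → ℝ≥0∞ := fun t => ENNReal.ofReal (V t)
  have hu : ∀ t, u t ≤ ENNReal.ofReal (K - B) := fun t => by
    have := hK (Set.mem_range_self t)
    exact ENNReal.ofReal_le_ofReal (by simp only [V]; linarith)
  have step : ∀ k, expectedState r f u k + ENNReal.ofReal J ≤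
      expectedStage r f c k + ENNReal.ofReal ε + expectedState r f u (k + 1) := fun k => by
    rw [expectedState_succ r f hV, ← expectedStage_state, ← expectedStage_const r f J k,
      ← expectedStage_const r f ε k,
      ← expectedStage_add r f hc (fun _ _ => hε),
      ← expectedStage_add r f (fun τ a => add_nonneg (hc τ a) hε) (nextValue_nonneg r hV),
      ← expectedStage_add r f (fun τ _ => hV τ) (fun _ _ => hJ)]
    refine expectedStage_mono r f fun x => ?_
    have := h (x.1 (Fin.last k)) (f k x)
    simp only [V, nextValue_add_const]
    linarith
  have sum : ∀ T : ℕ, (T : ℝ≥0∞) * ENNReal.ofReal J ≤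
      ∑ k ∈ Finset.range T, expectedStage r f c k + T * ENNReal.ofReal ε +
        expectedState r f u T := fun T => by
    induction T with
    | zero => simp
    | succ T ih =>
      calc ((T + 1 : ℕ) : ℝ≥0∞) * ENNReal.ofReal J
          = (T : ℝ≥0∞) * ENNReal.ofReal J + ENNReal.ofReal J := by push_cast; ring
        _ ≤ ∑ k ∈ Finset.range T, expectedStage r f c k + T * ENNReal.ofReal ε +
            (expectedState r f u T + ENNReal.ofReal J) := by rw [← add_assoc]; gcongr
        _ ≤ ∑ k ∈ Finset.range T, expectedStage r f c k + T * ENNReal.ofReal ε +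
            (expectedStage r f c T + ENNReal.ofReal ε + expectedState r f u (T + 1)) :=
            add_le_add le_rfl (step T)
        _ = _ := by rw [Finset.sum_range_succ]; push_cast; ring
  -- Here the terminal expectation has the wrong sign; being at most `K - B`, it vanishes after
  -- division by `T + 1`.
  have lim := (tendsto_const_div_natCast_add_one (K := ENNReal.ofReal (K - B))
    ENNReal.ofReal_ne_top)
  refine ENNReal.le_of_forall_pos_le_add fun δ hδ _ => ?_
  have hev : ∀ᶠ T : ℕ in atTop, ENNReal.ofReal (K - B) / ((T : ℝ≥0∞) + 1) < δ :=
    lim.eventually_lt_const (by simpa using hδ)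
  have key : ∀ᶠ T : ℕ in atTop, ENNReal.ofReal J - (ENNReal.ofReal ε + δ) ≤
      (∑ k ∈ Finset.range (T + 1), expectedStage r f c k) / ((T : ℝ≥0∞) + 1) := by
    filter_upwards [hev] with T hT
    rw [tsub_le_iff_right]
    calc ENNReal.ofReal J = ((T : ℝ≥0∞) + 1) * ENNReal.ofReal J / ((T : ℝ≥0∞) + 1) :=
          (mul_natCast_add_one_div _ T).symm
      _ ≤ (∑ k ∈ Finset.range (T + 1), expectedStage r f c k +
            ((T : ℝ≥0∞) + 1) * ENNReal.ofReal ε + ENNReal.ofReal (K - B)) /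
            ((T : ℝ≥0∞) + 1) := by
          refine ENNReal.div_le_div_right ?_ _
          have := sum (T + 1)
          push_cast at this
          refine this.trans ?_
          gcongr
          exact expectedState_le r f hu _
      _ = (∑ k ∈ Finset.range (T + 1), expectedStage r f c k) / ((T : ℝ≥0∞) + 1) +
            ENNReal.ofReal ε + ENNReal.ofReal (K - B) / ((T : ℝ≥0∞) + 1) := by
          rw [ENNReal.add_div, ENNReal.add_div, mul_natCast_add_one_div]
      _ ≤ _ := by rw [add_assoc]; gcongr
  have : ENNReal.ofReal J - (ENNReal.ofReal ε + δ) ≤ avgCost r f c :=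
    le_trans (le_liminf_of_le (by isBoundedDefault) key) liminf_le_limsup
  rw [add_assoc]
  exact tsub_le_iff_right.1 this

/-- An unbounded relative value function would leave the term `𝔼 V(τ(T)) / T`, which need not vanish
under an arbitrary policy. Bounded subsolutions avoid it, at the price of a slack `ε` that tends to
zero. -/
theorem le_avgCost (r : unitInterval) (f : Policy) {c : ℕ → Fin 2 → ℝ}
    (hc : ∀ τ a, 0 ≤ c τ a) {J : ℝ} (hJ : 0 ≤ J)
    (h : ∀ ε > 0, ∃ U : ℕ → ℝ, BddBelow (Set.range U) ∧ BddAbove (Set.range U) ∧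
      ∀ τ a, U τ ≤ c τ a - J + ε + nextValue r U τ a) :
    ENNReal.ofReal J ≤ avgCost r f c := by
  refine ENNReal.le_of_forall_pos_le_add fun ε hε _ => ?_
  obtain ⟨U, h1, h2, h3⟩ := h ε hε
  simpa using le_avgCost_add r f hc hJ ε.2 h1 h2 h3

theorem ennreal_limsup_add_le (u v : ℕ → ℝ≥0∞) :
    limsup (fun n => u n + v n) atTop ≤ limsup u atTop + limsup v atTop := by
  refine ENNReal.le_of_forall_pos_le_add fun ε hε hlt => ?_
  obtain ⟨hu, hv⟩ := ENNReal.add_lt_top.1 hlt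
  have hε2 : ((ε / 2 : NNReal) : ℝ≥0∞) ≠ 0 := by simpa using hε.ne'
  have h1 := eventually_lt_of_limsup_lt (ENNReal.lt_add_right hu.ne hε2)
  have h2 := eventually_lt_of_limsup_lt (ENNReal.lt_add_right hv.ne hε2)
  refine limsup_le_of_le (by isBoundedDefault) ?_
  filter_upwards [h1, h2] with n hn hn'
  refine (add_le_add hn.le hn'.le).trans_eq ?_
  rw [add_add_add_comm, ← ENNReal.coe_add, add_halves]

/-- Only subadditivity of the limsup is available, so the costly objective dominates the MDP cost.
Equality at the optimal policy comes from two separate Poisson equations. -/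
theorem avgCost_add_const_mul_le (r : unitInterval) (f : Policy) {c d : ℕ → Fin 2 → ℝ}
    (hc : ∀ τ a, 0 ≤ c τ a) (hd : ∀ τ a, 0 ≤ d τ a) {b : ℝ} (hb : 0 ≤ b) :
    avgCost r f (fun τ a => c τ a + b * d τ a) ≤
      avgCost r f c + ENNReal.ofReal b * avgCost r f d := by
  unfold avgCost
  rw [← ENNReal.limsup_const_mul_of_ne_top ENNReal.ofReal_ne_top]
  refine le_trans (le_of_eq ?_) (ennreal_limsup_add_le _ _)
  congr 1
  funext T
  rw [← mul_div_assoc, ← ENNReal.add_div, Finset.mul_sum, ← Finset.sum_add_distrib]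
  congr 1
  refine Finset.sum_congr rfl fun k _ => ?_
  rw [expectedStage_add r f hc (fun τ a => mul_nonneg hb (hd τ a)),
    expectedStage_const_mul r f hb]

/-! ### Threshold policies for monotone state costs -/

/-- A stationary policy `f` with Poisson equations for the state cost `p` and the communication
cost, whose combination satisfies the Bellman inequality and is approximated by bounded
subsolutions. -/
def HasThresholdSolution (p : ℕ → ℝ) (lam r : ℝ) : Prop :=
  ∃ (Je Jr : ℝ) (Ve h : ℕ → ℝ) (f : ℕ → Fin 2), 0 ≤ Je ∧ 0 ≤ Jr ∧
    BddBelow (Set.range Ve) ∧ BddBelow (Set.range h) ∧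
    (∀ τ, Ve τ = p τ - Je + nextValue r Ve τ (f τ)) ∧
    (∀ τ, h τ = commCost τ (f τ) - Jr + nextValue r h τ (f τ)) ∧
    (∀ τ a, Ve τ + lam * h τ ≤ p τ + lam * commCost τ a - (Je + lam * Jr) +
      nextValue r (fun t => Ve t + lam * h t) τ a) ∧
    ∀ ε > 0, ∃ U : ℕ → ℝ, BddBelow (Set.range U) ∧ BddAbove (Set.range U) ∧
      ∀ τ a, U τ ≤ p τ + lam * commCost τ a - (Je + lam * Jr) + ε + nextValue r U τ a

/-- Never transmitting is optimal if the accumulated cost deficit `∑ (J - p s)` is small. -/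
theorem hasThresholdSolution_never {p : ℕ → ℝ} {lam r J : ℝ} (hp0 : ∀ τ, 0 ≤ p τ)
    (hp : Monotone p) (hJ : ∀ τ, p τ ≤ J)
    (hJ' : ∀ ε > 0, ∃ N, J - p N ≤ ε)
    (hdef : ∀ θ, r * ∑ s ∈ Finset.range θ, (J - p s) ≤ lam) :
    HasThresholdSolution p lam r := by
  -- Without transmissions the Poisson equation is `V τ = p τ - J + V (τ + 1)`; normalizing `V 0 =
  -- 0` leaves the accumulated deficits.
  set V : ℕ → ℝ := fun τ => ∑ s ∈ Finset.range τ, (J - p s)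
  have hV0 : V 0 = 0 := by simp [V]
  have hVs : ∀ τ, V (τ + 1) = V τ + (J - p τ) := fun τ => Finset.sum_range_succ _ _
  have hVnn : ∀ τ, 0 ≤ V τ := fun τ => Finset.sum_nonneg fun s _ => sub_nonneg.2 (hJ s)
  have hVd : ∀ τ, r * V τ ≤ lam := hdef
  have hVm : Monotone V := monotone_nat_of_le_succ fun τ => by linarith [hVs τ, hJ τ]
  refine ⟨J, 0, V, 0, 0, (hp0 0).trans (hJ 0), le_rfl, ⟨0, ?_⟩, ⟨0, ?_⟩, fun τ => ?_, fun τ => ?_,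
    fun τ => ?_, fun ε hε => ?_⟩
  · rintro _ ⟨τ, rfl⟩; exact hVnn τ
  · rintro _ ⟨τ, rfl⟩; exact le_rfl
  · simp only [nextValue, hVs, zero_ne_one, if_false, Pi.zero_apply]; ring
  · simp [nextValue, commCost]
  · simp only [Fin.forall_fin_two, nextValue, commCost]
    simp only [Pi.zero_apply, mul_zero, add_zero, hV0, hVs]
    have := hVd (τ + 1)
    rw [hVs] at this
    constructor
    · simp only [zero_ne_one, if_false, Fin.val_zero, Nat.cast_zero, mul_zero]; linarith
    · simp; linarith
  · obtain ⟨N, hN⟩ := hJ' ε hε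
    -- Freezing `V` from `N` on loses an increment `J - p τ ≤ J - p N ≤ ε` per step.
    refine ⟨fun τ => V (min τ N), ⟨0, ?_⟩, ⟨V N, ?_⟩, fun τ => ?_⟩
    · rintro _ ⟨τ, rfl⟩; exact hVnn _
    · rintro _ ⟨τ, rfl⟩; exact hVm (min_le_right _ _)
    · have hstep : V (min τ N) ≤ p τ - J + ε + V (min (τ + 1) N) := by
        rcases lt_or_ge τ N with h | h
        · rw [min_eq_left h.le, min_eq_left h, hVs]; linarith
        · rw [min_eq_right h, min_eq_right (h.trans τ.le_succ)]
          linarith [hp h]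
      have := hVd (min (τ + 1) N)
      simp only [Fin.forall_fin_two, nextValue, commCost]
      constructor
      · simp; linarith
      · simp [hV0]; linarith

/-- The discounted cost `∑ q ^ j * p (τ + j)`. -/
def discSum (q : ℝ) (p : ℕ → ℝ) (τ : ℕ) : ℝ := ∑' j, q ^ j * p (τ + j)

theorem discSum_eq {q : ℝ} {p : ℕ → ℝ} {τ : ℕ} (hs : Summable fun j => q ^ j * p (τ + j)) :
    discSum q p τ = p τ + q * discSum q p (τ + 1) := by
  unfold discSum
  rw [hs.tsum_eq_zero_add, ← tsum_mul_left]
  simp only [pow_zero, one_mul, add_zero, pow_succ]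
  congr 1
  refine tsum_congr fun j => ?_
  rw [show τ + (j + 1) = τ + 1 + j by ring]
  ring

theorem discSum_mono {q : ℝ} {p : ℕ → ℝ} (hq : 0 ≤ q) (hp : Monotone p)
    (hs : ∀ τ, Summable fun j => q ^ j * p (τ + j)) : Monotone (discSum q p) := fun a b hab =>
  (hs a).tsum_le_tsum (fun j => by gcongr; exact hp (by omega)) (hs b)

/-- The weights `r (1-r)^j` form a geometric distribution, so `r * discSum (1 - r) p τ` is a mean of
values of `p` at and after `τ`. -/
theorem le_mul_discSum {r : ℝ} {p : ℕ → ℝ} (hr : 0 < r) (hr1 : r ≤ 1) (hp : Monotone p) {τ : ℕ}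
    (hs : Summable fun j => (1 - r) ^ j * p (τ + j)) : p τ ≤ r * discSum (1 - r) p τ := by
  have hg := hasSum_geometric_of_lt_one (sub_nonneg.2 hr1) (by linarith : 1 - r < 1)
  have h := hasSum_le (fun j => mul_le_mul_of_nonneg_left (hp (Nat.le_add_right τ j))
    (pow_nonneg (sub_nonneg.2 hr1) j)) (hg.mul_right (p τ)) hs.hasSum
  rw [sub_sub_cancel, inv_mul_le_iff₀ hr] at h
  exact h

theorem mul_discSum_le {r K : ℝ} {p : ℕ → ℝ} (hr : 0 < r) (hr1 : r ≤ 1) (hK : ∀ τ, p τ ≤ K)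
    {τ : ℕ} (hs : Summable fun j => (1 - r) ^ j * p (τ + j)) :
    r * discSum (1 - r) p τ ≤ K := by
  have hg := hasSum_geometric_of_lt_one (sub_nonneg.2 hr1) (by linarith : 1 - r < 1)
  have h := hasSum_le (fun j => mul_le_mul_of_nonneg_left (hK (τ + j))
    (pow_nonneg (sub_nonneg.2 hr1) j)) hs.hasSum (hg.mul_right K)
  rw [sub_sub_cancel, le_inv_mul_iff₀ hr] at h
  exact h

theorem summable_truncate {q : ℝ} {p : ℕ → ℝ} (hq : 0 ≤ q) (hp0 : ∀ τ, 0 ≤ p τ) (hp : Monotone p)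
    {τ : ℕ} (hs : Summable fun j => q ^ j * p (τ + j)) (N : ℕ) :
    Summable fun j => q ^ j * p (min (τ + j) N) :=
  hs.of_nonneg_of_le (fun _ => mul_nonneg (pow_nonneg hq _) (hp0 _)) fun _ => by
    gcongr; exact hp (min_le_left _ _)

theorem tendsto_discSum_truncate {q : ℝ} {p : ℕ → ℝ} (hq : 0 ≤ q) (hp0 : ∀ τ, 0 ≤ p τ)
    (hp : Monotone p) {τ : ℕ} (hs : Summable fun j => q ^ j * p (τ + j)) :
    Tendsto (fun N => discSum q (fun t => p (min t N)) τ) atTop (nhds (discSum q p τ)) := by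
  refine tendsto_tsum_of_dominated_convergence hs (fun j => ?_)
    (Eventually.of_forall fun N j => ?_)
  · refine tendsto_const_nhds.congr' ?_
    filter_upwards [eventually_ge_atTop (τ + j)] with N hN
    rw [min_eq_left hN]
  · rw [Real.norm_of_nonneg (mul_nonneg (pow_nonneg hq _) (hp0 _))]
    gcongr
    exact hp (min_le_left _ _)

theorem bddBelow_threshold {θ : ℕ} {F G : ℕ → ℝ} (hG : ∀ τ, θ ≤ τ → G θ ≤ G τ) :
    BddBelow (Set.range fun τ => if τ < θ then F τ else G τ) := by
  have hfin : BddBelow ((fun τ => F τ) '' Set.Iio θ) := ((Set.finite_Iio θ).image _).bddBelow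
  refine (hfin.union (bddBelow_singleton (a := G θ)) |>.imp fun b hb => ?_)
  rintro _ ⟨τ, rfl⟩
  dsimp only
  split_ifs with h
  · exact hb (Or.inl ⟨τ, h, rfl⟩)
  · exact (hb (Or.inr rfl)).trans (hG τ (not_lt.1 h))

theorem bddAbove_threshold {θ : ℕ} {F G : ℕ → ℝ} {K : ℝ} (hG : ∀ τ, G τ ≤ K) :
    BddAbove (Set.range fun τ => if τ < θ then F τ else G τ) := by
  have hfin : BddAbove ((fun τ => F τ) '' Set.Iio θ) := ((Set.finite_Iio θ).image _).bddAbove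
  refine (hfin.union (bddAbove_singleton (a := K)) |>.imp fun b hb => ?_)
  rintro _ ⟨τ, rfl⟩
  dsimp only
  split_ifs with h
  · exact hb (Or.inl ⟨τ, h, rfl⟩)
  · exact (hG τ).trans (hb (Or.inr rfl))

/-- The average cost of the policy that transmits in the states `τ ≥ θ`. -/
def thresholdCost (p : ℕ → ℝ) (lam r : ℝ) (θ : ℕ) : ℝ :=
  (∑ s ∈ Finset.range θ, p s + discSum (1 - r) p θ + lam / r) / (θ + 1 / r)

/-- A Poisson equation for a threshold policy. -/
theorem poisson_threshold {θ : ℕ} {r J : ℝ} {c : ℕ → ℝ} {F G : ℕ → ℝ}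
    (hF0 : F 0 = 0) (hF : ∀ τ, τ < θ → F τ = c τ - J + F (τ + 1)) (hFG : F θ = G θ)
    (hG : ∀ τ, θ ≤ τ → G τ = c τ - J + (1 - r) * G (τ + 1)) (τ : ℕ) :
    (if τ < θ then F τ else G τ) = c τ - J +
      nextValue r (fun t => if t < θ then F t else G t) τ (if τ < θ then 0 else 1) := by
  have h0 : (if 0 < θ then F 0 else G 0) = 0 := by
    split_ifs with h
    · exact hF0
    · obtain rfl : θ = 0 := by omega
      rw [← hFG, hF0]
  unfold nextValue
  by_cases h : τ < θ
  · rw [if_pos h, if_pos h, if_neg (by simp), hF τ h]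
    rcases (Nat.succ_le_of_lt h).eq_or_lt with h' | h'
    · simp [show τ + 1 = θ from h', hFG]
    · simp [show τ + 1 < θ from h']
  · beta_reduce
    rw [if_neg h, if_neg h, if_pos rfl, h0, if_neg (by omega), hG τ (by omega)]
    ring

/-- A threshold function, lowered by `δ` below the threshold, is an approximate subsolution of the
Bellman equation. -/
theorem subsolution_threshold {θ : ℕ} {lam r J δ : ℝ} {p F G : ℕ → ℝ} (hr : 0 ≤ r) (hr1 : r ≤ 1)
    (hδ : 0 ≤ δ) (hF0 : F 0 = 0) (hF : ∀ τ, τ < θ → F τ = p τ - J + F (τ + 1))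
    (hFr : ∀ τ, τ < θ → r * F (τ + 1) ≤ lam) (hFG : F θ ≤ G θ + δ)
    (hG : ∀ τ, θ ≤ τ → G τ ≤ p τ + lam - J + (1 - r) * G (τ + 1))
    (hGr : ∀ τ, θ ≤ τ → lam ≤ r * (G (τ + 1) + δ)) (τ : ℕ) (a : Fin 2) :
    (if τ < θ then F τ - δ else G τ) ≤ p τ + lam * commCost τ a - J + r * δ +
      nextValue r (fun t => if t < θ then F t - δ else G t) τ a := by
  have hq : 0 ≤ 1 - r := sub_nonneg.2 hr1
  set U : ℕ → ℝ := fun t => if t < θ then F t - δ else G t with hU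
  -- A success leads to state `0`, where lowering costs at most `δ`. The slack `r * δ` is needed
  -- only at or above the threshold, where `G` is not lowered.
  have hU0 : 0 ≤ r * (U 0 + δ) := by
    refine mul_nonneg hr ?_
    simp only [hU]
    split_ifs with h
    · linarith
    · obtain rfl : θ = 0 := by omega
      linarith
  have hrδ : 0 ≤ r * δ := mul_nonneg hr hδ
  revert a
  simp only [Fin.forall_fin_two, nextValue, commCost, Fin.val_zero, Fin.val_one,
    Nat.cast_zero, Nat.cast_one, zero_ne_one, if_false, if_true, mul_zero, mul_one, add_zero]
  by_cases h : τ < θ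
  · rw [if_pos h]
    have hU1 : F (τ + 1) ≤ U (τ + 1) + δ := by
      simp only [hU]
      split_ifs with h'
      · linarith
      · obtain rfl : θ = τ + 1 := by omega
        exact hFG
    have h1 := hF τ h
    have h2 := hFr τ h
    have h3 := mul_le_mul_of_nonneg_left hU1 hq
    constructor <;> linarith
  · rw [if_neg h]
    have hU1 : U (τ + 1) = G (τ + 1) := if_neg (by omega)
    have h1 := hG τ (not_lt.1 h)
    have h2 := hGr τ (not_lt.1 h)
    rw [hU1]
    constructor <;> linarith

/-- The value function is `F` below `θ` and `G` above; they meet at `θ` precisely because `J` is the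
threshold cost. Comparing the two actions reduces the Bellman inequality to `r * F (τ + 1) ≤ lam`
below the threshold and `lam ≤ r * G (τ + 1)` above it, which follow from `hlow` and `hup`. -/
theorem hasThresholdSolution_threshold {p : ℕ → ℝ} {lam r : ℝ} (hp0 : ∀ τ, 0 ≤ p τ)
    (hp : Monotone p) (hr : 0 < r) (hr1 : r ≤ 1)
    (hs : ∀ τ, Summable fun j => (1 - r) ^ j * p (τ + j)) (θ : ℕ)
    (hup : thresholdCost p lam r θ ≤ r * discSum (1 - r) p (θ + 1))
    (hlow : θ ≠ 0 → r * discSum (1 - r) p θ ≤ thresholdCost p lam r θ) :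
    HasThresholdSolution p lam r := by
  have hq : 0 ≤ 1 - r := sub_nonneg.2 hr1
  set S := discSum (1 - r) p with hS
  have hSe : ∀ τ, S τ = p τ + (1 - r) * S (τ + 1) := fun τ => discSum_eq (hs τ)
  have hSm : Monotone S := discSum_mono hq hp hs
  have hpS : ∀ τ, p τ ≤ r * S τ := fun τ => le_mul_discSum hr hr1 hp (hs τ)
  have hS0 : ∀ τ, 0 ≤ S τ := fun τ => tsum_nonneg fun j => mul_nonneg (pow_nonneg hq _) (hp0 _)
  set L : ℝ := θ + 1 / r with hL
  have hL0 : 0 < L := by positivity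
  set P : ℕ → ℝ := fun τ => ∑ s ∈ Finset.range τ, p s
  have hPs : ∀ τ, P (τ + 1) = P τ + p τ := fun τ => Finset.sum_range_succ _ _
  have hP0 : P 0 = 0 := by simp [P]
  set Je := (P θ + S θ) / L
  set Jr := 1 / r / L
  set J := Je + lam * Jr with hJdef
  have hJe : Je * L = P θ + S θ := div_mul_cancel₀ _ hL0.ne'
  have hJr : Jr * L = 1 / r := div_mul_cancel₀ _ hL0.ne'
  have hJ : J = thresholdCost p lam r θ := by
    simp only [J, Je, Jr, thresholdCost, ← hL]
    simp only [← hS]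
    ring
  rw [← hJ] at hup hlow
  have hlow' : ∀ τ, τ < θ → r * S (τ + 1) ≤ J := fun τ h =>
    le_trans (by gcongr; exact hSm h) (hlow (by omega))
  set Fe : ℕ → ℝ := fun τ => τ * Je - P τ
  -- With value `0` at state `0`, a constant `k` added to `S` must satisfy `k = -Je + (1 - r) * k`.
  set Ge : ℕ → ℝ := fun τ => S τ - Je / r
  set Fr : ℕ → ℝ := fun τ => τ * Jr
  set Gr : ℕ → ℝ := fun _ => (1 - Jr) / r
  have hFGe : Fe θ = Ge θ := by
    simp only [Fe, Ge]; rw [hL] at hJe; linear_combination hJe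
  have hFGr : Fr θ = Gr θ := by
    simp only [Fr, Gr]; rw [hL] at hJr; linear_combination hJr
  set Ve : ℕ → ℝ := fun τ => if τ < θ then Fe τ else Ge τ
  set h : ℕ → ℝ := fun τ => if τ < θ then Fr τ else Gr τ
  set f : ℕ → Fin 2 := fun τ => if τ < θ then 0 else 1
  have hPe : ∀ τ, Ve τ = p τ - Je + nextValue r Ve τ (f τ) :=
    poisson_threshold (by simp [Fe, hP0]) (fun τ _ => by simp [Fe, hPs]; ring) hFGe
      (fun τ _ => by simp only [Ge]; rw [hSe τ]; field_simp; ring)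
  have hPr : ∀ τ, h τ = commCost τ (f τ) - Jr + nextValue r h τ (f τ) :=
    poisson_threshold (c := fun τ => commCost τ (f τ)) (by simp [Fr])
      (fun τ hτ => by simp [Fr, f, hτ, commCost]; ring) hFGr
      (fun τ hτ => by simp [Gr, f, not_lt.2 hτ, commCost]; field_simp; ring)
  set F : ℕ → ℝ := fun τ => τ * J - P τ
  have hF0 : F 0 = 0 := by simp [F, hP0]
  have hFs : ∀ τ, F τ = p τ - J + F (τ + 1) := fun τ => by simp [F, hPs]; ring
  set G : ℕ → ℝ := fun τ => S τ + (lam - J) / r with hG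
  have hGs : ∀ τ, G τ = p τ + lam - J + (1 - r) * G (τ + 1) := fun τ => by
    simp only [G]; rw [hSe τ]; field_simp; ring
  have hFG : F θ = G θ := by
    simp only [F, G, hJdef]; rw [hL] at hJe hJr; linear_combination hJe + lam * hJr
  have hV : (fun t => Ve t + lam * h t) = fun τ => if τ < θ then F τ else G τ := by
    funext τ
    simp only [Ve, h, F, G, Fe, Ge, Fr, Gr, J]
    split_ifs <;> ring
  have hV' : ∀ τ, Ve τ + lam * h τ = if τ < θ then F τ else G τ := fun τ => congrFun hV τ
  -- Backward induction from the threshold: the bound holds at `θ` since `F θ = G θ`, and `F`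
  -- increases there because `p ≤ J` below `θ`.
  have hFk : ∀ k τ, τ + k + 1 = θ → r * F (τ + 1) ≤ lam := fun k => by
    induction k with
    | zero =>
      intro τ hk
      have h1 := hlow' τ (by omega)
      have h2 : r * ((lam - J) / r) = lam - J := mul_div_cancel₀ _ hr.ne'
      rw [show τ + 1 = θ by omega] at h1 ⊢
      rw [hFG]
      simp only [G]
      linarith
    | succ k ih =>
      intro τ hk
      have h1 := ih (τ + 1) (by omega)
      have h2 := hFs (τ + 1)
      have h3 : p (τ + 1) ≤ J := (hpS _).trans (hlow' τ (by omega))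
      refine le_trans ?_ h1
      gcongr
      linarith
  have hFr : ∀ τ, τ < θ → r * F (τ + 1) ≤ lam := fun τ hτ => hFk (θ - τ - 1) τ (by omega)
  refine ⟨Je, Jr, Ve, h, f, div_nonneg (add_nonneg (Finset.sum_nonneg fun s _ => hp0 s) (hS0 θ))
    hL0.le, by positivity, bddBelow_threshold fun τ hτ => ?_, bddBelow_threshold fun _ _ => le_rfl,
    hPe, hPr, fun τ a => ?_, fun ε hε => ?_⟩
  · simp only [Ge]; linarith [hSm hτ]
  · rw [hV', hV]
    have := subsolution_threshold (G := G) hr.le hr1 le_rfl hF0 (fun τ _ => hFs τ) hFr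
      (by rw [hFG, add_zero]) (fun τ _ => (hGs τ).le) (fun τ hτ => ?_) τ a
    · simpa using this
    · have h1 := hSm (Nat.succ_le_succ hτ)
      have h2 : r * ((lam - J) / r) = lam - J := mul_div_cancel₀ _ hr.ne'
      have h3 := mul_le_mul_of_nonneg_left h1 hr.le
      simp only [G]
      simp only [Nat.succ_eq_add_one] at h3
      linarith
  · have hev : ∀ τ, ∀ᶠ N in atTop, S τ - ε < discSum (1 - r) (fun t => p (min t N)) τ := fun τ =>
      (tendsto_discSum_truncate hq hp0 hp (hs τ)).eventually_const_lt (sub_lt_self _ hε)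
    -- Closeness at `θ` and `θ + 1` suffices: monotonicity of `T` carries the second bound to all
    -- later states.
    obtain ⟨N, hN, hN1⟩ := ((hev θ).and (hev (θ + 1))).exists
    set T := discSum (1 - r) fun t => p (min t N) with hT
    have hsN : ∀ τ, Summable fun j => (1 - r) ^ j * p (min (τ + j) N) := fun τ =>
      summable_truncate hq hp0 hp (hs τ) N
    have hTm : Monotone T := discSum_mono hq (fun a b hab => hp (min_le_min_right N hab)) hsN
    have hTe : ∀ τ, T τ = p (min τ N) + (1 - r) * T (τ + 1) := fun τ =>
      discSum_eq (p := fun t => p (min t N)) (hsN τ)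
    have hTb : ∀ τ, r * T τ ≤ p N := fun τ =>
      mul_discSum_le hr hr1 (fun τ => hp (min_le_right τ N)) (hsN τ)
    set H : ℕ → ℝ := fun τ => T τ + (lam - J) / r with hH
    have hc : r * ((lam - J) / r) = lam - J := mul_div_cancel₀ _ hr.ne'
    refine ⟨fun τ => if τ < θ then F τ - ε else H τ, bddBelow_threshold fun τ hτ => ?_,
      bddAbove_threshold (K := p N / r + (lam - J) / r) fun τ => ?_, fun τ a => ?_⟩
    · simp only [H]; linarith [hTm hτ]
    · simp only [H]
      gcongr
      rw [le_div_iff₀ hr, mul_comm]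
      exact hTb τ
    · refine (subsolution_threshold (p := p) (lam := lam) (J := J) hr.le hr1 hε.le hF0
        (fun τ _ => hFs τ) hFr ?_ (fun τ _ => ?_) (fun τ hτ => ?_) τ a).trans ?_
      · rw [hFG]; simp only [G, H]; linarith
      · simp only [H]
        have := hp (min_le_left τ N)
        rw [hTe τ]
        linarith
      · have h1 := hTm (Nat.succ_le_succ hτ)
        have h2 : S (θ + 1) ≤ T (τ + 1) + ε := by
          simp only [Nat.succ_eq_add_one] at h1; linarith
        have h3 := mul_le_mul_of_nonneg_left h2 hr.le
        simp only [H]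
        linarith
      · have : r * ε ≤ ε := mul_le_of_le_one_left hε.le hr1
        linarith

/-- Raising the threshold adds one step to the mean cycle and, since `S θ = p θ + (1 - r) S (θ +
1)`, adds `r S (θ + 1)` to its mean cost. -/
theorem thresholdCost_succ {p : ℕ → ℝ} {lam r : ℝ} (hr : 0 < r) {θ : ℕ}
    (hs : Summable fun j => (1 - r) ^ j * p (θ + j)) :
    thresholdCost p lam r (θ + 1) * (θ + 1 + 1 / r) =
      thresholdCost p lam r θ * (θ + 1 / r) + r * discSum (1 - r) p (θ + 1) := by
  have h1 : (θ : ℝ) + 1 / r ≠ 0 := by positivity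
  have h2 : (θ : ℝ) + 1 + 1 / r ≠ 0 := by positivity
  unfold thresholdCost
  rw [div_mul_cancel₀ _ h1]
  push_cast
  rw [div_mul_cancel₀ _ h2, Finset.sum_range_succ, discSum_eq hs]
  ring

theorem exists_sub_le_of_isLUB {p : ℕ → ℝ} {J : ℝ} (h : IsLUB (Set.range p) J) {ε : ℝ}
    (hε : 0 < ε) : ∃ N, J - p N ≤ ε := by
  obtain ⟨_, ⟨N, rfl⟩, h1, _⟩ := h.exists_between (sub_lt_self J hε)
  exact ⟨N, by linarith⟩

/-- For monotone state costs whose discounted sums converge, some threshold policy (possibly with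
infinite threshold) solves the problem. -/
theorem hasThresholdSolution {p : ℕ → ℝ} {lam r : ℝ} (hp0 : ∀ τ, 0 ≤ p τ)
    (hp : Monotone p) (hlam : 0 ≤ lam) (hr : 0 ≤ r) (hr1 : r ≤ 1)
    (hs : 0 < r → ∀ τ, Summable fun j => (1 - r) ^ j * p (τ + j))
    (hb : r = 0 → BddAbove (Set.range p)) : HasThresholdSolution p lam r := by
  rcases hr.eq_or_lt' with rfl | hr
  · have hlub := isLUB_ciSup (hb rfl)
    exact hasThresholdSolution_never hp0 hp (fun τ => hlub.1 ⟨τ, rfl⟩)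
      (fun ε hε => exists_sub_le_of_isLUB hlub hε) (fun θ => by simpa using hlam)
  specialize hs hr
  set D := thresholdCost p lam r with hD
  by_cases hex : ∃ θ, D θ ≤ r * discSum (1 - r) p (θ + 1)
  · classical
    refine hasThresholdSolution_threshold hp0 hp hr hr1 hs (Nat.find hex) (Nat.find_spec hex)
      fun h0 => ?_
    obtain ⟨θ, hθ⟩ := Nat.exists_eq_succ_of_ne_zero h0
    -- The predecessor fails the test, so its threshold cost exceeds `r S` at the new threshold;
    -- hence so does the weighted mean of the two, up to equality.
    have hlt := Nat.find_min hex (m := θ) (by omega)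
    rw [hθ]
    have h1 := thresholdCost_succ (lam := lam) hr (hs θ)
    have h2 : (0 : ℝ) < θ + 1 / r := by positivity
    rw [← hD] at h1 ⊢
    simp only [Nat.succ_eq_add_one]
    nlinarith
  · push Not at hex
    -- If the test never succeeds, `D` keeps decreasing and dominates `p`, so the supremum of `p` is
    -- finite.
    have hanti : Antitone D := antitone_nat_of_succ_le fun θ => by
      have h1 := thresholdCost_succ (lam := lam) hr (hs θ)
      have h2 : (0 : ℝ) < θ + 1 / r := by positivity
      have h3 := hex θ
      rw [← hD] at h1
      nlinarith
    have hpD : ∀ θ τ, p τ ≤ D θ := fun θ τ => by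
      have h1 := le_mul_discSum hr hr1 hp (hs (max θ τ + 1))
      exact (hp (by omega)).trans (h1.trans ((hex _).le.trans (hanti (le_max_left θ τ))))
    have hlub := isLUB_ciSup (f := p) ⟨D 0, by rintro _ ⟨τ, rfl⟩; exact hpD 0 τ⟩
    set J := ⨆ τ, p τ
    have hpJ : ∀ τ, p τ ≤ J := fun τ => hlub.1 ⟨τ, rfl⟩
    refine hasThresholdSolution_never hp0 hp hpJ
      (fun ε hε => exists_sub_le_of_isLUB hlub hε) (fun θ => ?_)
    -- Multiplying `J ≤ D θ` by the cycle length and using `r S θ ≤ J` gives the deficit bound.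
    have h1 : J ≤ D θ := ciSup_le (hpD θ)
    have h2 := mul_discSum_le hr hr1 hpJ (hs θ)
    have h3 : (0 : ℝ) < θ + 1 / r := by positivity
    simp only [hD, thresholdCost] at h1
    rw [le_div_iff₀ h3] at h1
    have h4 := mul_le_mul_of_nonneg_left h1 hr.le
    have h5 : r * (lam / r) = lam := mul_div_cancel₀ _ hr.ne'
    have h6 : r * (1 / r) = 1 := mul_div_cancel₀ _ hr.ne'
    rw [Finset.sum_sub_distrib, Finset.sum_const, Finset.card_range, nsmul_eq_mul]
    linear_combination h4 + h2 + h5 - J * h6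

/-! ### Growth and monotonicity of the error covariance -/

section Growth

attribute [local instance] Matrix.frobeniusNormedRing Matrix.frobeniusNormedAlgebra

theorem spectralRadius_ne_top {n : ℕ} (A : Matrix (Fin n) (Fin n) ℂ) :
    spectralRadius ℂ A ≠ ⊤ := by
  refine ((spectrum.spectralRadius_le_pow_nnnorm_pow_one_div ℂ A 0).trans_lt ?_).ne
  finiteness

/-- Powers of a matrix grow at most like powers of any number beyond its spectral radius. -/
theorem exists_norm_pow_le {n : ℕ} (A : Matrix (Fin n) (Fin n) ℝ) {σ : ℝ} (hσ : specRad A < σ) :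
    ∃ K, 0 ≤ K ∧ ∀ t, ‖A ^ t‖ ≤ K * σ ^ t := by
  have hσ0 : 0 < σ := lt_of_le_of_lt ENNReal.toReal_nonneg hσ
  -- The Frobenius norm is unchanged by complexification, so Gelfand's formula over `ℂ` controls the
  -- real powers.
  have hmap : ∀ t, ‖(A.map (algebraMap ℝ ℂ)) ^ t‖ = ‖A ^ t‖ := fun t => by
    have : (A.map (algebraMap ℝ ℂ)) ^ t = (A ^ t).map (algebraMap ℝ ℂ) := by
      simpa using (map_pow (algebraMap ℝ ℂ).mapMatrix A t).symm
    rw [this]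
    exact Matrix.frobenius_norm_map_eq _ _ (by simp)
  have hlim := spectrum.pow_nnnorm_pow_one_div_tendsto_nhds_spectralRadius
    (A.map (algebraMap ℝ ℂ))
  have hlt : spectralRadius ℂ (A.map (algebraMap ℝ ℂ)) < ENNReal.ofReal σ :=
    (ENNReal.lt_ofReal_iff_toReal_lt (spectralRadius_ne_top _)).2 hσ
  have hev : ∀ᶠ t : ℕ in atTop, ‖A ^ t‖ ≤ σ ^ t := by
    filter_upwards [hlim.eventually_lt_const hlt, eventually_gt_atTop 0] with t ht ht0
    have h1 := ENNReal.rpow_le_rpow ht.le (Nat.cast_nonneg (α := ℝ) t)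
    rw [← ENNReal.rpow_mul, one_div, inv_mul_cancel₀ (by positivity), ENNReal.rpow_one,
      ENNReal.rpow_natCast, ← ENNReal.ofReal_pow hσ0.le, ← enorm_eq_nnnorm, ← ofReal_norm,
      hmap] at h1
    exact (ENNReal.ofReal_le_ofReal_iff (by positivity)).1 h1
  obtain ⟨N, hN⟩ := eventually_atTop.1 hev
  -- The sum absorbs the finitely many exponents not covered by Gelfand's formula.
  refine ⟨1 + ∑ t ∈ Finset.range N, ‖A ^ t‖ / σ ^ t, by positivity, fun t => ?_⟩
  have hp : 0 < σ ^ t := by positivity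
  have hs : 0 ≤ ∑ t ∈ Finset.range N, ‖A ^ t‖ / σ ^ t := by positivity
  rcases lt_or_ge t N with h | h
  · rw [← div_le_iff₀ hp]
    have := Finset.single_le_sum (f := fun t => ‖A ^ t‖ / σ ^ t) (fun i _ => by positivity)
      (Finset.mem_range.2 h)
    linarith
  · refine (hN t h).trans ?_
    nlinarith

theorem exists_trace_le {n : ℕ} : ∃ K, 0 ≤ K ∧
    ∀ X : Matrix (Fin n) (Fin n) ℝ, X.trace ≤ K * ‖X‖ := by
  refine ⟨n, n.cast_nonneg, fun X => ?_⟩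
  have h : ∀ i, X i i ≤ ‖X‖ := fun i => by
    rw [Matrix.frobenius_norm_def, ← Real.sqrt_eq_rpow]
    refine Real.le_sqrt_of_sq_le ?_
    have h1 : ‖X i i‖ ^ (2 : ℝ) ≤ ∑ j, ‖X i j‖ ^ (2 : ℝ) :=
      Finset.single_le_sum (f := fun j => ‖X i j‖ ^ (2 : ℝ)) (fun _ _ => by positivity)
        (Finset.mem_univ i)
    have h2 : ∑ j, ‖X i j‖ ^ (2 : ℝ) ≤ ∑ i, ∑ j, ‖X i j‖ ^ (2 : ℝ) :=
      Finset.single_le_sum (f := fun i => ∑ j, ‖X i j‖ ^ (2 : ℝ)) (fun _ _ => by positivity)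
        (Finset.mem_univ i)
    simpa using h1.trans h2
  simpa [Matrix.trace] using Finset.sum_le_sum fun i (_ : i ∈ Finset.univ) => h i

theorem exists_trace_conj_pow_le {n : ℕ} (A X : Matrix (Fin n) (Fin n) ℝ) {σ : ℝ}
    (hσ : specRad A < σ) : ∃ K, 0 ≤ K ∧ ∀ t, (A ^ t * X * Aᵀ ^ t).trace ≤ K * (σ ^ 2) ^ t := by
  obtain ⟨K, hK0, hK⟩ := exists_norm_pow_le A hσ
  obtain ⟨D, hD0, hD⟩ := exists_trace_le (n := n)
  refine ⟨D * (K ^ 2 * ‖X‖), by positivity, fun t => ?_⟩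
  have h1 : ‖Aᵀ ^ t‖ = ‖A ^ t‖ := by
    rw [← Matrix.transpose_pow]; exact Matrix.frobenius_norm_transpose _
  calc (A ^ t * X * Aᵀ ^ t).trace ≤ D * ‖A ^ t * X * Aᵀ ^ t‖ := hD _
    _ ≤ D * (‖A ^ t‖ * ‖X‖ * ‖A ^ t‖) := by
        gcongr
        refine (norm_mul_le _ _).trans ?_
        rw [h1]
        gcongr
        exact norm_mul_le _ _
    _ ≤ D * (K * σ ^ t * ‖X‖ * (K * σ ^ t)) := by
        have := hK t
        have := (norm_nonneg _).trans this
        gcongr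
    _ = _ := by rw [← pow_mul, mul_comm 2 t, pow_mul]; ring

end Growth

theorem trace_errCov {n : ℕ} (A W P : Matrix (Fin n) (Fin n) ℝ) (τ : ℕ) :
    (errCov A W P τ).trace =
      (A ^ τ * P * Aᵀ ^ τ).trace + ∑ t ∈ Finset.range τ, (A ^ t * W * Aᵀ ^ t).trace := by
  rw [errCov, Matrix.trace_add, Matrix.trace_sum]

theorem exists_trace_errCov_le {n : ℕ} (A W P : Matrix (Fin n) (Fin n) ℝ) {σ : ℝ}
    (hσ : specRad A < σ) : ∃ K, 0 ≤ K ∧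
      ∀ τ, (errCov A W P τ).trace ≤ K * ((σ ^ 2) ^ τ + ∑ t ∈ Finset.range τ, (σ ^ 2) ^ t) := by
  obtain ⟨K₁, h₁, H₁⟩ := exists_trace_conj_pow_le A P hσ
  obtain ⟨K₂, h₂, H₂⟩ := exists_trace_conj_pow_le A W hσ
  refine ⟨K₁ + K₂, by positivity, fun τ => ?_⟩
  rw [trace_errCov, mul_add, Finset.mul_sum]
  refine add_le_add ((H₁ τ).trans ?_) (Finset.sum_le_sum fun t _ => (H₂ t).trans ?_)
  · gcongr; linarith
  · gcongr; linarith

theorem summable_pow_mul_trace_errCov {n : ℕ} (A W P : Matrix (Fin n) (Fin n) ℝ) {q : ℝ}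
    (hnn : ∀ τ, 0 ≤ (errCov A W P τ).trace)
    (hq0 : 0 ≤ q) (hq1 : q < 1) (h : specRad A ^ 2 * q < 1) (τ : ℕ) :
    Summable fun j => q ^ j * (errCov A W P (τ + j)).trace := by
  have hρ : 0 ≤ specRad A := ENNReal.toReal_nonneg
  -- Taking `σ > 1` as well makes the geometric sum of the noise terms of order `σ ^ (2 * τ)`, also
  -- for a stable `A`.
  obtain ⟨σ, hσ, hσ1, hσq⟩ : ∃ σ, specRad A < σ ∧ 1 < σ ∧ σ ^ 2 * q < 1 := by
    have hc : ContinuousAt (fun s : ℝ => s ^ 2 * q) (max (specRad A) 1) := by fun_prop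
    have hlt : (max (specRad A) 1) ^ 2 * q < 1 := by
      rcases max_choice (specRad A) 1 with h' | h' <;> rw [h'] <;> linarith
    have hev := (hc.eventually_lt_const hlt).filter_mono
      (nhdsWithin_le_nhds (s := Set.Ioi (max (specRad A) 1)))
    obtain ⟨σ, h1, h2⟩ := (hev.and self_mem_nhdsWithin).exists
    exact ⟨σ, (le_max_left _ _).trans_lt h2, (le_max_right _ _).trans_lt h2, h1⟩
  obtain ⟨K, hK, H⟩ := exists_trace_errCov_le A W P hσ
  have hβ : 1 < σ ^ 2 := by nlinarith
  have hgeo : Summable fun j : ℕ => (σ ^ 2 * q) ^ j :=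
    summable_geometric_of_lt_one (by positivity) hσq
  refine Summable.of_nonneg_of_le (fun j => mul_nonneg (pow_nonneg hq0 _) (hnn _)) (fun j => ?_)
    (hgeo.mul_left (K * (1 + 1 / (σ ^ 2 - 1)) * (σ ^ 2) ^ τ))
  have h2 : ∑ t ∈ Finset.range (τ + j), (σ ^ 2) ^ t ≤ (σ ^ 2) ^ (τ + j) / (σ ^ 2 - 1) := by
    rw [geom_sum_eq hβ.ne']
    have : 0 < σ ^ 2 - 1 := by linarith
    gcongr
    linarith
  calc q ^ j * (errCov A W P (τ + j)).trace
      ≤ q ^ j * (K * ((σ ^ 2) ^ (τ + j) + (σ ^ 2) ^ (τ + j) / (σ ^ 2 - 1))) := by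
        gcongr
        refine (H _).trans ?_
        gcongr
    _ = _ := by rw [mul_pow, pow_add]; ring

theorem bddAbove_trace_errCov {n : ℕ} (A W P : Matrix (Fin n) (Fin n) ℝ)
    (h : specRad A ^ 2 < 1) : BddAbove (Set.range fun τ => (errCov A W P τ).trace) := by
  have hρ : 0 ≤ specRad A := ENNReal.toReal_nonneg
  obtain ⟨σ, hσ, hσ1⟩ := exists_between (show specRad A < 1 by nlinarith)
  obtain ⟨K, hK, H⟩ := exists_trace_errCov_le A W P hσ
  have hσ0 : 0 < σ := hρ.trans_lt hσ
  have hβ : σ ^ 2 < 1 := by nlinarith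
  refine ⟨K * (1 + (1 - σ ^ 2)⁻¹), ?_⟩
  rintro _ ⟨τ, rfl⟩
  refine (H τ).trans ?_
  gcongr
  · exact pow_le_one₀ (by positivity) hβ.le
  · rw [← tsum_geometric_of_lt_one (by positivity) hβ]
    exact (summable_geometric_of_lt_one (by positivity) hβ).sum_le_tsum _
      fun _ _ => by positivity

theorem posSemidef_conj_pow {n : ℕ} (A : Matrix (Fin n) (Fin n) ℝ) {X : Matrix (Fin n) (Fin n) ℝ}
    (hX : X.PosSemidef) (t : ℕ) : (A ^ t * X * Aᵀ ^ t).PosSemidef := by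
  have := hX.mul_mul_conjTranspose_same (A ^ t)
  rwa [Matrix.conjTranspose_eq_transpose_of_trivial, Matrix.transpose_pow] at this

theorem trace_errCov_nonneg {n : ℕ} (A : Matrix (Fin n) (Fin n) ℝ)
    {W P : Matrix (Fin n) (Fin n) ℝ} (hW : W.PosSemidef) (hP : P.PosSemidef) (τ : ℕ) :
    0 ≤ (errCov A W P τ).trace := by
  rw [trace_errCov]
  exact add_nonneg (posSemidef_conj_pow A hP τ).trace_nonneg
    (Finset.sum_nonneg fun t _ => (posSemidef_conj_pow A hW t).trace_nonneg)

/-- A measurement does not increase the error covariance. -/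
theorem posSemidef_sub_kalmanCorrect {n m : ℕ} (C : Matrix (Fin m) (Fin n) ℝ)
    {R : Matrix (Fin m) (Fin m) ℝ} (hR : R.PosDef) {M : Matrix (Fin n) (Fin n) ℝ}
    (hM : M.PosSemidef) : (M - kalmanCorrect C R M).PosSemidef := by
  have hMt : Mᵀ = M := by
    simpa [Matrix.conjTranspose_eq_transpose_of_trivial] using hM.isHermitian.eq
  have h1 : (C * M * Cᵀ).PosSemidef := by
    simpa [Matrix.conjTranspose_eq_transpose_of_trivial] using hM.mul_mul_conjTranspose_same C
  have h2 : (C * M * Cᵀ + R)⁻¹.PosSemidef := (Matrix.PosDef.posSemidef_add h1 hR).inv.posSemidef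
  have h3 := h2.mul_mul_conjTranspose_same (M * Cᵀ)
  have : M - kalmanCorrect C R M = M * Cᵀ * (C * M * Cᵀ + R)⁻¹ * (M * Cᵀ)ᴴ := by
    simp [kalmanCorrect, Matrix.conjTranspose_eq_transpose_of_trivial, hMt, Matrix.mul_assoc]
  rwa [this]

/-- With `M` the prediction from `P`, consecutive covariances differ by `A ^ τ * (M - P) * Aᵀ ^ τ`.
Stationarity says that `P` is the correction of `M`, so `M - P` is positive semidefinite. -/
theorem monotone_trace_errCov {n m : ℕ} {A : Matrix (Fin n) (Fin n) ℝ}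
    {C : Matrix (Fin m) (Fin n) ℝ} {W : Matrix (Fin n) (Fin n) ℝ} {R : Matrix (Fin m) (Fin m) ℝ}
    {P : Matrix (Fin n) (Fin n) ℝ} (hW : W.PosSemidef) (hR : R.PosDef)
    (hP : IsSteadyStateCov A C W R P) : Monotone fun τ => (errCov A W P τ).trace := by
  refine monotone_nat_of_le_succ fun τ => ?_
  have hM : (kalmanPredict A W P).PosSemidef := by
    simpa [kalmanPredict] using (posSemidef_conj_pow A hP.posSemidef 1).add hW
  have h := posSemidef_sub_kalmanCorrect C hR hM
  rw [hP.fixed] at h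
  have h1 := (posSemidef_conj_pow A h τ).trace_nonneg
  have h2 : A ^ τ * (kalmanPredict A W P - P) * Aᵀ ^ τ =
      A ^ (τ + 1) * P * Aᵀ ^ (τ + 1) + A ^ τ * W * Aᵀ ^ τ - A ^ τ * P * Aᵀ ^ τ := by
    rw [kalmanPredict, pow_succ A, pow_succ' Aᵀ]
    noncomm_ring
  rw [h2, Matrix.trace_sub, Matrix.trace_add] at h1
  rw [trace_errCov, trace_errCov, Finset.sum_range_succ]
  linarith

end SensorScheduling

end

/-! ### Verification of optimality for the scheduling problem -/

theorem mainTheorem9 {n m : ℕ}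
    (A : Matrix (Fin n) (Fin n) ℝ) (C : Matrix (Fin m) (Fin n) ℝ)
    (W : Matrix (Fin n) (Fin n) ℝ) (R : Matrix (Fin m) (Fin m) ℝ)
    (Pbar : Matrix (Fin n) (Fin n) ℝ)
    (hW : W.PosSemidef) (hR : R.PosDef)
    (hdet : SensorScheduling.Detectable A C)
    (hstab : SensorScheduling.StabilizableSqrt A W)
    (hP : SensorScheduling.IsSteadyStateCov A C W R Pbar)
    (lam : ℝ) (hlam : 0 ≤ lam) (r : unitInterval)
    (hr : SensorScheduling.specRad A ^ 2 * (1 - (r : ℝ)) < 1) :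
    ∃ (J : ℝ) (V : ℕ → ℝ) (f : ℕ → Fin 2),
      -- `J` is the (finite) optimal value of the costly communication problem and of the MDP
      0 ≤ J ∧
      ENNReal.ofReal J =
        (⨅ g : SensorScheduling.Policy, SensorScheduling.costlyObjective A W Pbar lam r g) ∧
      ENNReal.ofReal J =
        (⨅ g : ℕ → ℕ → Fin 2, SensorScheduling.avgCost r (SensorScheduling.markovPolicy g)
          (SensorScheduling.stageCost A W Pbar lam)) ∧
      -- `V` is bounded below and solves the Bellman optimality equation
      BddBelow (Set.range V) ∧
      (∀ τ : ℕ, V τ = ⨅ a : Fin 2, SensorScheduling.bellmanTerm A W Pbar lam r V J τ a) ∧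
      -- the stationary policy `f` attains the minimum in every state
      (∀ τ : ℕ, V τ = SensorScheduling.bellmanTerm A W Pbar lam r V J τ (f τ)) ∧
      -- and `f` is optimal, among all admissible policies
      SensorScheduling.costlyObjective A W Pbar lam r (SensorScheduling.stationaryPolicy f) =
        ENNReal.ofReal J ∧
      SensorScheduling.avgCost r (SensorScheduling.stationaryPolicy f)
        (SensorScheduling.stageCost A W Pbar lam) = ENNReal.ofReal J ∧
      (∀ g : SensorScheduling.Policy, ENNReal.ofReal J ≤
        SensorScheduling.avgCost r g (SensorScheduling.stageCost A W Pbar lam)) := by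

  have hnn := SensorScheduling.trace_errCov_nonneg A hW hP.posSemidef
  have hr1 : (r : ℝ) ≤ 1 := r.2.2
  obtain ⟨Je, Jr, Ve, h, f, hJe, hJr, hVe, hh, hPe, hPr, hB, hU⟩ :=
    SensorScheduling.hasThresholdSolution hnn
      (SensorScheduling.monotone_trace_errCov hW hR hP) hlam r.2.1 hr1
      (fun h0 => SensorScheduling.summable_pow_mul_trace_errCov A W Pbar hnn (by linarith)
        (by linarith) hr)
      (fun h0 => SensorScheduling.bddAbove_trace_errCov A W Pbar (by simpa [h0] using hr))
  have hest : ∀ τ a, 0 ≤ SensorScheduling.estCost A W Pbar τ a := fun τ _ => hnn τ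
  have hcomm : ∀ (τ : ℕ) (a : Fin 2), 0 ≤ SensorScheduling.commCost τ a := fun _ a => by
    unfold SensorScheduling.commCost; positivity
  have hstage : ∀ τ a, 0 ≤ SensorScheduling.stageCost A W Pbar lam τ a := fun τ a =>
    add_nonneg (hest τ a) (mul_nonneg hlam (hcomm τ a))
  have hJ : 0 ≤ Je + lam * Jr := by positivity
  have hlow : ∀ g : SensorScheduling.Policy, ENNReal.ofReal (Je + lam * Jr) ≤
      SensorScheduling.avgCost r g (SensorScheduling.stageCost A W Pbar lam) := fun g =>
    SensorScheduling.le_avgCost r g hstage hJ hU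
  have hsub : ∀ g : SensorScheduling.Policy,
      SensorScheduling.avgCost r g (SensorScheduling.stageCost A W Pbar lam) ≤
        SensorScheduling.costlyObjective A W Pbar lam r g := fun g =>
    SensorScheduling.avgCost_add_const_mul_le r g hest hcomm hlam
  have hopt : SensorScheduling.costlyObjective A W Pbar lam r
      (SensorScheduling.stationaryPolicy f) ≤ ENNReal.ofReal (Je + lam * Jr) := by
    rw [ENNReal.ofReal_add hJe (by positivity), ENNReal.ofReal_mul hlam]
    refine add_le_add ?_ (mul_le_mul_right ?_ _)
    · exact SensorScheduling.avgCost_le r _ hest hJe hVe fun k x => (hPe (x.1 (Fin.last k))).ge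
    · exact SensorScheduling.avgCost_le r _ hcomm hJr hh fun k x => (hPr (x.1 (Fin.last k))).ge
  have hJcostly := le_antisymm hopt ((hlow _).trans (hsub _))
  have hJavg := le_antisymm ((hsub _).trans hopt) (hlow (SensorScheduling.stationaryPolicy f))
  have hterm : ∀ τ a, SensorScheduling.bellmanTerm A W Pbar lam r (fun t => Ve t + lam * h t)
      (Je + lam * Jr) τ a = (SensorScheduling.errCov A W Pbar τ).trace +
        lam * SensorScheduling.commCost τ a - (Je + lam * Jr) +
        SensorScheduling.nextValue r (fun t => Ve t + lam * h t) τ a := fun τ a => by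
    rw [SensorScheduling.bellmanTerm, SensorScheduling.tsum_mul_transProb]
    simp only [SensorScheduling.stageCost, SensorScheduling.estCost]
    ring
  have hatt : ∀ τ, Ve τ + lam * h τ = SensorScheduling.bellmanTerm A W Pbar lam r
      (fun t => Ve t + lam * h t) (Je + lam * Jr) τ (f τ) := fun τ => by
    rw [hterm, SensorScheduling.nextValue_add_mul]
    linear_combination hPe τ + lam * hPr τ
  refine ⟨Je + lam * Jr, fun t => Ve t + lam * h t, f, hJ,
    -- Each infimum is bounded below by `hlow` and attained at the stationary policy `f`, which is
    -- also Markovian.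
    le_antisymm (le_iInf fun g => (hlow g).trans (hsub g)) ((iInf_le _ _).trans hopt),
    le_antisymm (le_iInf fun g => hlow _) ((iInf_le _ fun _ => f).trans hJavg.le),
    ?_, fun τ => le_antisymm (le_ciInf fun a => ?_) ?_, hatt, hJcostly, hJavg, hlow⟩
  · obtain ⟨b, hb⟩ := hVe
    obtain ⟨d, hd⟩ := hh
    refine ⟨b + lam * d, ?_⟩
    rintro _ ⟨τ, rfl⟩
    exact add_le_add (hb ⟨τ, rfl⟩) (mul_le_mul_of_nonneg_left (hd ⟨τ, rfl⟩) hlam)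
  · rw [hterm]; exact hB τ a
  · beta_reduce
    rw [hatt]
    exact ciInf_le (Set.finite_range _).bddBelow _
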